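/- Consider $M$ devices $D_1,\dots,D_M$. The energy-transfer and information-transfer channel coefficients $g_i,h_i$ ($i\ge 1$) are mutually independent, each circularly symmetric complex Gaussian $CN(0,1)$ (zero mean, unit variance). Let $a,b\in\mathbb R$ and $c>0$ with $ac>b$, let $P_t>0$, $\sigma_n^2>0$, $0<t_1<1$ and $t_2=1-t_1$. Device $D_i$ harvests the energy $$E_i=t_1\left(\frac{aP_t|g_i|^2+b}{P_t|g_i|^2+c}-\frac bc\right),$$ and its SNR at the receiver is $X_i=\frac{|h_i|^2}{t_2\sigma_n^2}E_i$. Let $F$ be the common CDF of the $X_i$. Fix $k\ge1$. For $M\ge k$ let $i^*=i^*(M)$ be the index of a device whose SNR is the $k$-th largest among $X_1,\dots,X_M$ (SNR-based selection). For a threshold level $Q\in\mathbb R$ put $x=2^{Q/t_2}-1$, and let $$\Pi^{(k)}_{\mathrm{SBS}}(x)=\mathbb P\{t_2\log_2(1+X_{i^*})\le Q\}$$ be the outage probability; it depends on $M$. Put $$\eta_M=F^{-1}\left(1-\tfrac1M\right),\qquad \xi_M=F^{-1}\left(1-\tfrac1{eM}\right)-\eta_M,\qquad G^{(k)}(z)=\exp(-e^{-z})\sum_{j=0}^{k-1}\frac{e^{-jz}}{j!},$$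 where $F^{-1}(p)=\inf\{y:F(y)\ge p\}$. Then: (i) for every $M\ge2$, $F(\eta_M)=1-\frac1M$, $F(\eta_M+\xi_M)=1-\frac1{eM}$ and $\xi_M>0$; (ii) for every $z\in\mathbb R$, $\mathbb P\left\{\frac{X_{i^*}-\eta_M}{\xi_M}\le z\right\}\to G^{(k)}(z)$ as $M\to\infty$; (iii) as $M\to\infty$, uniformly in $Q\in\mathbb R$ (that is, in $x>-1$), $$\Pi^{(k)}_{\mathrm{SBS}}(x)-\exp\left(-e^{-(x-\eta_M)/\xi_M}\right)\sum_{j=0}^{k-1}\frac{e^{-j(x-\eta_M)/\xi_M}}{j!}\longrightarrow 0 .$$ -/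

import Mathlib

open MeasureTheory ProbabilityTheory Filter Topology

noncomputable section

/-- The law `CN(0,1)` on `ℂ`: circularly symmetric complex Gaussian, zero mean, unit variance
(independent real and imaginary parts, each real Gaussian of variance `1/2`). -/
def stdComplexGaussian : Measure ℂ :=
  ((gaussianReal 0 (1 / 2)).prod (gaussianReal 0 (1 / 2))).map Complex.measurableEquivRealProd.symm

/-- The system parameters: coefficients `a`, `b`, `c` of the rectification circuit, transmit
power `Pt`, length `t₁` of the harvesting phase (the slot has length one), noise variance `σ2`. -/
structure WPCN where
  a : ℝ
  b : ℝ
  c : ℝ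
  Pt : ℝ
  t₁ : ℝ
  σ2 : ℝ
  c_pos : 0 < c
  /-- the harvested energy increases with the received power -/
  b_lt : b < a * c
  Pt_pos : 0 < Pt
  t₁_pos : 0 < t₁
  t₁_lt_one : t₁ < 1
  σ2_pos : 0 < σ2

namespace WPCN

variable (W : WPCN)

/-- Length of the communication phase. -/
def t₂ : ℝ := 1 - W.t₁

/-- Energy harvested (non-linear model) by a device with energy-transfer coefficient `g`. -/
def energy (g : ℂ) : ℝ :=
  W.t₁ * ((W.a * W.Pt * ‖g‖ ^ 2 + W.b) / (W.Pt * ‖g‖ ^ 2 + W.c) - W.b / W.c)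

/-- End-to-end SNR of a device with energy-transfer coefficient `g` and
information-transfer coefficient `h`. -/
def snr (g h : ℂ) : ℝ := ‖h‖ ^ 2 / (W.t₂ * W.σ2) * W.energy g

/-- Probability that the information rate of a device with (random) SNR `X` does not exceed
the threshold level `Q`. -/
def outage {Ω : Type*} [MeasurableSpace Ω] (P : Measure Ω) (X : Ω → ℝ) (Q : ℝ) : ℝ :=
  P.real {ω | W.t₂ * Real.logb 2 (1 + X ω) ≤ Q}

end WPCN

/-- Among the devices `0, …, M - 1` with performance values `x 0, …, x (M - 1)`, the device `i` is
the `k`-th best one: `x i` is the `k`-th largest of these values, counted with multiplicity. -/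
def IsKthBest (M k : ℕ) (x : ℕ → ℝ) (i : ℕ) : Prop :=
  i < M ∧ ((Finset.range M).filter (fun j => x i < x j)).card < k ∧
    k ≤ ((Finset.range M).filter (fun j => x i ≤ x j)).card

/-- The (generalized) inverse of a distribution function. -/
def invCDF (F : ℝ → ℝ) (p : ℝ) : ℝ := sInf {y | p ≤ F y}

/-- Location constant `η = F⁻¹(1 - 1/M)`. -/
def normEta (F : ℝ → ℝ) (M : ℕ) : ℝ := invCDF F (1 - 1 / (M : ℝ))

/-- Scale constant `ξ = F⁻¹(1 - 1/(eM)) - η`. -/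
def normXi (F : ℝ → ℝ) (M : ℕ) : ℝ :=
  invCDF F (1 - 1 / (Real.exp 1 * (M : ℝ))) - normEta F M

/-- The limit law `G⁽ᵏ⁾(z) = exp(-e^{-z}) ∑_{j<k} e^{-jz} / j!`. -/
def gumbelKth (k : ℕ) (z : ℝ) : ℝ :=
  Real.exp (-Real.exp (-z)) * ∑ j ∈ Finset.range k, Real.exp (-(j * z)) / (j.factorial : ℝ)

end

/-!
The SNR of a device is `‖h‖ ^ 2` times a bounded gain depending on `g`, and `‖h‖ ^ 2` is exponential
with mean `1` (`stdComplexGaussian_norm_sq_gt`). Conditioning on `g`, the tail `1 - F` is on `[0, ∞)`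
the Laplace transform of the law of the inverse gain `R` (`WPCN.measure_snr_gt`). Such a transform is
continuous, and as the essential infimum `r₀ = WPCN.gainSup⁻¹` of `R` is positive, Laplace's principle
gives `(1 - F) (x + t) / (1 - F) x → exp (-r₀ t)` as `x → ∞`
(`tendsto_laplaceTransform_shift`); no asymptotics of Bessel functions is needed. Thus `F` is in the
Gumbel domain of attraction with constant auxiliary function `r₀⁻¹`, the scales `ξ_M` converge to
`r₀⁻¹`, and `M (1 - F) (η_M + z ξ_M) → exp (-z)` (`tendsto_mul_tail_normalized`).

The `k`-th largest SNR is at most `y` exactly if fewer than `k` devices exceed `y`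
(`IsKthBest.le_iff`). The number of exceedances is binomial, and its Poisson limit gives the limit
law (`tendsto_measureReal_card_exceedances_lt`). The outage probability is the distribution function
of the selected SNR at `x`, so uniformity in the threshold is Pólya's theorem
(`eventually_forall_abs_sub_lt_of_monotone`). The statement about `F⁻¹` rests on the continuity of
`F` (`apply_invCDF`).
-/

/-! ### Laplace transforms -/

section Laplace

variable {α : Type*} [MeasurableSpace α]

/-- The Laplace transform `x ↦ ∫ exp (-x R) dν` of the law of `R` under `ν`. It is meant for
`x ≥ 0` and `ν`-almost everywhere positive `R`, where the integrand is bounded by `1`. -/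
noncomputable def laplaceTransform (ν : Measure α) (R : α → ℝ) (x : ℝ) : ℝ :=
  ∫ a, Real.exp (-(x * R a)) ∂ν

variable {ν : Measure α} {R : α → ℝ}

lemma integrable_exp_neg_mul [IsProbabilityMeasure ν] (hR : Measurable R)
    (hpos : ∀ᵐ a ∂ν, 0 < R a) {x : ℝ} (hx : 0 ≤ x) :
    Integrable (fun a => Real.exp (-(x * R a))) ν := by
  refine Integrable.of_bound (by fun_prop) 1 ?_
  filter_upwards [hpos] with a ha
  rw [Real.norm_of_nonneg (Real.exp_nonneg _), Real.exp_le_one_iff]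
  nlinarith [mul_nonneg hx ha.le]

lemma laplaceTransform_pos [IsProbabilityMeasure ν] (hR : Measurable R)
    (hpos : ∀ᵐ a ∂ν, 0 < R a) {x : ℝ} (hx : 0 ≤ x) :
    0 < laplaceTransform ν R x :=
  integral_exp_pos (integrable_exp_neg_mul hR hpos hx)

lemma laplaceTransform_zero [IsProbabilityMeasure ν] : laplaceTransform ν R 0 = 1 := by
  simp [laplaceTransform]

lemma antitoneOn_laplaceTransform [IsProbabilityMeasure ν] (hR : Measurable R)
    (hpos : ∀ᵐ a ∂ν, 0 < R a) : AntitoneOn (laplaceTransform ν R) (Set.Ici 0) := by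
  intro x hx y hy hxy
  refine integral_mono_ae (integrable_exp_neg_mul hR hpos hy) (integrable_exp_neg_mul hR hpos hx) ?_
  filter_upwards [hpos] with a ha
  exact Real.exp_le_exp.2 (by nlinarith)

lemma continuousOn_laplaceTransform [IsProbabilityMeasure ν] (hR : Measurable R)
    (hpos : ∀ᵐ a ∂ν, 0 < R a) : ContinuousOn (laplaceTransform ν R) (Set.Ici 0) := by
  refine continuousOn_of_dominated (bound := fun _ => 1) (fun x _ => by fun_prop) ?_
    (integrable_const _) (ae_of_all _ fun a => by fun_prop)
  intro x hx
  filter_upwards [hpos] with a ha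
  rw [Real.norm_of_nonneg (Real.exp_nonneg _), Real.exp_le_one_iff]
  nlinarith [mul_nonneg (Set.mem_Ici.1 hx) ha.le]

/-- As `x → ∞`, the set where `R` exceeds `s` contributes negligibly to the Laplace transform at
`x`, provided that `R` takes values at most `r < s` with positive probability: the contribution is
at most `exp (-x s)`, while the whole is at least a constant times `exp (-x r)`. -/
lemma tendsto_integral_far_div_laplaceTransform [IsProbabilityMeasure ν] (hR : Measurable R)
    (hpos : ∀ᵐ a ∂ν, 0 < R a) {r s : ℝ} (hrs : r < s) (hr : 0 < ν {a | R a ≤ r}) :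
    Tendsto (fun x => (∫ a in {a | s < R a}, Real.exp (-(x * R a)) ∂ν) / laplaceTransform ν R x)
      atTop (𝓝 0) := by
  have hm : 0 < ν.real {a | R a ≤ r} := ENNReal.toReal_pos hr.ne' (measure_ne_top _ _)
  have hb : Tendsto (fun x : ℝ => Real.exp (-(x * (s - r))) / ν.real {a | R a ≤ r})
      atTop (𝓝 0) := by
    simpa using (Real.tendsto_exp_neg_atTop_nhds_zero.comp
      (tendsto_id.atTop_mul_const (sub_pos.2 hrs))).div_const (ν.real {a | R a ≤ r})
  refine squeeze_zero' ?_ ?_ hb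
  · filter_upwards [eventually_ge_atTop 0] with x hx
    exact div_nonneg (integral_nonneg fun a => (Real.exp_nonneg _))
      (laplaceTransform_pos hR hpos hx).le
  · filter_upwards [eventually_ge_atTop 0] with x hx
    have hint := integrable_exp_neg_mul hR hpos hx
    have h1 : ∫ a in {a | s < R a}, Real.exp (-(x * R a)) ∂ν ≤ Real.exp (-(x * s)) := by
      have : ∫ a in {a | s < R a}, Real.exp (-(x * R a)) ∂ν
          ≤ ∫ a in {a | s < R a}, Real.exp (-(x * s)) ∂ν := by
        refine setIntegral_mono_on hint.integrableOn (integrable_const _).integrableOn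
          (measurableSet_lt measurable_const hR) fun a ha => Real.exp_le_exp.2 ?_
        have ha' : s < R a := ha
        nlinarith [mul_le_mul_of_nonneg_left ha'.le hx]
      refine this.trans ?_
      rw [setIntegral_const, smul_eq_mul]
      exact mul_le_of_le_one_left (Real.exp_nonneg _) measureReal_le_one
    have h2 : ν.real {a | R a ≤ r} * Real.exp (-(x * r)) ≤ laplaceTransform ν R x := by
      have h3 : ∫ a in {a | R a ≤ r}, Real.exp (-(x * r)) ∂ν
          ≤ ∫ a in {a | R a ≤ r}, Real.exp (-(x * R a)) ∂ν := by
        refine setIntegral_mono_on (integrable_const _).integrableOn hint.integrableOn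
          (measurableSet_le hR measurable_const) fun a ha => Real.exp_le_exp.2 ?_
        have ha' : R a ≤ r := ha
        nlinarith [mul_le_mul_of_nonneg_left ha' hx]
      rw [setIntegral_const, smul_eq_mul] at h3
      exact h3.trans (setIntegral_le_integral hint (ae_of_all _ fun a => Real.exp_nonneg _))
    rw [div_le_div_iff₀ (laplaceTransform_pos hR hpos hx) hm]
    calc _ ≤ Real.exp (-(x * s)) * ν.real {a | R a ≤ r} := by gcongr
      _ = Real.exp (-(x * (s - r))) * (ν.real {a | R a ≤ r} * Real.exp (-(x * r))) := by
        rw [mul_left_comm, ← Real.exp_add]; ring_nf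
      _ ≤ _ := by gcongr

lemma tendsto_laplaceTransform_shift_of_nonneg [IsProbabilityMeasure ν] (hR : Measurable R) {r₀ : ℝ}
    (hr₀ : 0 < r₀) (hle : ∀ᵐ a ∂ν, r₀ ≤ R a) (hinf : ∀ r, r₀ < r → 0 < ν {a | R a ≤ r})
    {t : ℝ} (ht : 0 ≤ t) :
    Tendsto (fun x => laplaceTransform ν R (x + t) / laplaceTransform ν R x) atTop
      (𝓝 (Real.exp (-(r₀ * t)))) := by
  have hpos : ∀ᵐ a ∂ν, 0 < R a := hle.mono fun a ha => hr₀.trans_le ha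
  refine tendsto_order.2 ⟨fun l hl => ?_, fun u hu => ?_⟩
  -- lower bound: up to a negligible part, `R ≤ s` for any `s > r₀`
  · have hc : Tendsto (fun s => Real.exp (-(s * t))) (𝓝[>] r₀) (𝓝 (Real.exp (-(r₀ * t)))) :=
      (Continuous.tendsto (by fun_prop) r₀).mono_left nhdsWithin_le_nhds
    obtain ⟨s, hs, hsr⟩ := ((hc.eventually (lt_mem_nhds hl)).and
      (self_mem_nhdsWithin : Set.Ioi r₀ ∈ 𝓝[>] r₀)).exists
    obtain ⟨r, hr, hrs⟩ := exists_between (show r₀ < s from hsr)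
    have h1 : Tendsto (fun x => Real.exp (-(s * t)) * (1 - (∫ a in {a | s < R a},
        Real.exp (-(x * R a)) ∂ν) / laplaceTransform ν R x)) atTop (𝓝 (Real.exp (-(s * t)))) := by
      simpa using ((tendsto_integral_far_div_laplaceTransform hR hpos hrs
        (hinf r hr)).const_sub 1).const_mul (Real.exp (-(s * t)))
    filter_upwards [h1.eventually (lt_mem_nhds hs), eventually_ge_atTop 0] with x hx hx0
    refine hx.trans_le ?_
    have hS := laplaceTransform_pos hR hpos hx0
    have hint := integrable_exp_neg_mul hR hpos hx0
    have hint' := integrable_exp_neg_mul hR hpos (add_nonneg hx0 ht)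
    have hms : MeasurableSet {a | s < R a} := measurableSet_lt measurable_const hR
    rw [le_div_iff₀ hS, mul_assoc, sub_mul, div_mul_cancel₀ _ hS.ne', one_mul]
    have hsplit := integral_add_compl hms hint
    have h2 : laplaceTransform ν R x - ∫ a in {a | s < R a}, Real.exp (-(x * R a)) ∂ν
        = ∫ a in {a | s < R a}ᶜ, Real.exp (-(x * R a)) ∂ν := by
      rw [laplaceTransform]; linarith
    rw [h2, ← integral_const_mul]
    refine le_trans (setIntegral_mono_on (hint.const_mul _).integrableOn hint'.integrableOn hms.compl
      fun a ha => ?_) (setIntegral_le_integral hint' (ae_of_all _ fun a => Real.exp_nonneg _))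
    have ha' : R a ≤ s := not_lt.1 ha
    rw [← Real.exp_add]
    exact Real.exp_le_exp.2 (by nlinarith)
  · filter_upwards [eventually_ge_atTop 0] with x hx0
    refine lt_of_le_of_lt ?_ hu
    have hint := integrable_exp_neg_mul hR hpos hx0
    rw [div_le_iff₀ (laplaceTransform_pos hR hpos hx0), laplaceTransform, laplaceTransform,
      ← integral_const_mul]
    refine integral_mono_ae (integrable_exp_neg_mul hR hpos (add_nonneg hx0 ht))
      (hint.const_mul _) ?_
    filter_upwards [hle] with a ha
    rw [← Real.exp_add]
    exact Real.exp_le_exp.2 (by nlinarith)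

/-- If `r₀ > 0` is the essential infimum of `R`, then the Laplace transform of the law of `R` has
asymptotically the memoryless decay `exp (-r₀ x)`: translating its argument by a fixed `t` multiplies
it by `exp (-r₀ t)` in the limit. -/
lemma tendsto_laplaceTransform_shift [IsProbabilityMeasure ν] (hR : Measurable R) {r₀ : ℝ}
    (hr₀ : 0 < r₀) (hle : ∀ᵐ a ∂ν, r₀ ≤ R a) (hinf : ∀ r, r₀ < r → 0 < ν {a | R a ≤ r})
    (t : ℝ) :
    Tendsto (fun x => laplaceTransform ν R (x + t) / laplaceTransform ν R x) atTop
      (𝓝 (Real.exp (-(r₀ * t)))) := by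
  rcases le_total 0 t with ht | ht
  · exact tendsto_laplaceTransform_shift_of_nonneg hR hr₀ hle hinf ht
  · have h := (tendsto_laplaceTransform_shift_of_nonneg hR hr₀ hle hinf (neg_nonneg.2 ht)).inv₀
      (Real.exp_pos _).ne'
    have h' := h.comp (tendsto_atTop_add_const_right atTop t tendsto_id)
    rw [← Real.exp_neg] at h'
    convert h' using 2
    · simp
    · simp

end Laplace

/-! ### Gumbel domain of attraction -/

section ExtremeValue

variable {S : ℝ → ℝ} {r : ℝ} {η ξ : ℕ → ℝ}

lemma tendsto_atTop_of_mul_eq_one (hS : Antitone S) (hpos : ∀ x, 0 < S x)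
    (hη : ∀ᶠ M : ℕ in atTop, M * S (η M) = 1) : Tendsto η atTop atTop := by
  refine tendsto_atTop.2 fun B => ?_
  have h1 : Tendsto (fun M : ℕ => (M : ℝ) * S B) atTop atTop :=
    tendsto_natCast_atTop_atTop.atTop_mul_const (hpos B)
  filter_upwards [hη, h1.eventually_gt_atTop 1] with M h2 h3
  by_contra! h
  have := mul_le_mul_of_nonneg_left (hS h.le) (Nat.cast_nonneg (α := ℝ) M)
  linarith

/-- Under `M * S (η M) = 1`, the expected number `M * S (η M + t)` of exceedances of `η M + t`
converges, the tail `S` having the constant auxiliary function `r⁻¹`. -/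
lemma tendsto_mul_tail_add_const (hS : Antitone S) (hpos : ∀ x, 0 < S x)
    (hshift : ∀ t, Tendsto (fun x => S (x + t) / S x) atTop (𝓝 (Real.exp (-(r * t)))))
    (hη : ∀ᶠ M : ℕ in atTop, M * S (η M) = 1) (t : ℝ) :
    Tendsto (fun M : ℕ => M * S (η M + t)) atTop (𝓝 (Real.exp (-(r * t)))) := by
  refine ((hshift t).comp (tendsto_atTop_of_mul_eq_one hS hpos hη)).congr' ?_
  filter_upwards [hη] with M hM
  have := (hpos (η M)).ne'
  rw [Function.comp_apply, div_eq_iff this, mul_right_comm, hM, one_mul]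

/-- The shift `t` may vary with `M`, since `S` is monotone and the limit is continuous in `t`. -/
lemma tendsto_mul_tail_add (hS : Antitone S) (hpos : ∀ x, 0 < S x)
    (hshift : ∀ t, Tendsto (fun x => S (x + t) / S x) atTop (𝓝 (Real.exp (-(r * t)))))
    (hη : ∀ᶠ M : ℕ in atTop, M * S (η M) = 1) {c : ℕ → ℝ} {t : ℝ}
    (hc : Tendsto c atTop (𝓝 t)) :
    Tendsto (fun M : ℕ => M * S (η M + c M)) atTop (𝓝 (Real.exp (-(r * t)))) := by
  have hcont : Tendsto (fun u => Real.exp (-(r * u))) (𝓝 t) (𝓝 (Real.exp (-(r * t)))) :=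
    Continuous.tendsto (by fun_prop) t
  refine tendsto_order.2 ⟨fun l hl => ?_, fun u hu => ?_⟩
  · obtain ⟨s, hs, hst⟩ := (((hcont.mono_left nhdsWithin_le_nhds).eventually
      (lt_mem_nhds hl)).and (self_mem_nhdsWithin : Set.Ioi t ∈ 𝓝[>] t)).exists
    filter_upwards [(tendsto_mul_tail_add_const hS hpos hshift hη s).eventually (lt_mem_nhds hs),
      hc.eventually (gt_mem_nhds hst)] with M h1 h2
    exact h1.trans_le (mul_le_mul_of_nonneg_left (hS (by linarith)) (Nat.cast_nonneg M))
  · obtain ⟨s, hs, hst⟩ := (((hcont.mono_left nhdsWithin_le_nhds).eventually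
      (gt_mem_nhds hu)).and (self_mem_nhdsWithin : Set.Iio t ∈ 𝓝[<] t)).exists
    filter_upwards [(tendsto_mul_tail_add_const hS hpos hshift hη s).eventually (gt_mem_nhds hs),
      hc.eventually (lt_mem_nhds hst)] with M h1 h2
    exact (mul_le_mul_of_nonneg_left (hS (by linarith)) (Nat.cast_nonneg M)).trans_lt h1

/-- The scale constants defined by `M * S (η M + ξ M) = exp (-1)` converge to the auxiliary function
`r⁻¹`. -/
lemma tendsto_scale (hr : 0 < r) (hS : Antitone S) (hpos : ∀ x, 0 < S x)
    (hshift : ∀ t, Tendsto (fun x => S (x + t) / S x) atTop (𝓝 (Real.exp (-(r * t)))))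
    (hη : ∀ᶠ M : ℕ in atTop, M * S (η M) = 1)
    (hξ : ∀ᶠ M : ℕ in atTop, M * S (η M + ξ M) = Real.exp (-1)) :
    Tendsto ξ atTop (𝓝 r⁻¹) := by
  refine tendsto_order.2 ⟨fun l hl => ?_, fun u hu => ?_⟩
  · have h1 : Real.exp (-1) < Real.exp (-(r * l)) := by
      refine Real.exp_lt_exp.2 (neg_lt_neg ?_)
      have := mul_lt_mul_of_pos_left hl hr
      rwa [mul_inv_cancel₀ hr.ne'] at this
    filter_upwards [(tendsto_mul_tail_add_const hS hpos hshift hη l).eventually (lt_mem_nhds h1),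
      hξ] with M h2 h3
    by_contra! h
    have := mul_le_mul_of_nonneg_left (hS (add_le_add_right h (η M))) (Nat.cast_nonneg (α := ℝ) M)
    linarith
  · have h1 : Real.exp (-(r * u)) < Real.exp (-1) := by
      refine Real.exp_lt_exp.2 (neg_lt_neg ?_)
      rwa [← inv_lt_iff_one_lt_mul₀' hr]
    filter_upwards [(tendsto_mul_tail_add_const hS hpos hshift hη u).eventually (gt_mem_nhds h1),
      hξ] with M h2 h3
    by_contra! h
    have := mul_le_mul_of_nonneg_left (hS (add_le_add_right h (η M))) (Nat.cast_nonneg (α := ℝ) M)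
    linarith

lemma tendsto_mul_tail_normalized (hr : 0 < r) (hS : Antitone S) (hpos : ∀ x, 0 < S x)
    (hshift : ∀ t, Tendsto (fun x => S (x + t) / S x) atTop (𝓝 (Real.exp (-(r * t)))))
    (hη : ∀ᶠ M : ℕ in atTop, M * S (η M) = 1)
    (hξ : ∀ᶠ M : ℕ in atTop, M * S (η M + ξ M) = Real.exp (-1)) (z : ℝ) :
    Tendsto (fun M : ℕ => M * S (η M + z * ξ M)) atTop (𝓝 (Real.exp (-z))) := by
  have h := tendsto_mul_tail_add hS hpos hshift hη
    ((tendsto_scale hr hS hpos hshift hη hξ).const_mul z)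
  rwa [show r * (z * r⁻¹) = z by field_simp] at h

end ExtremeValue

/-! ### Order statistics of independent identically distributed variables -/

/-- The `k`-th largest value is at most `y` exactly if fewer than `k` values exceed `y`; ties do not
matter. -/
lemma IsKthBest.le_iff {M k : ℕ} {x : ℕ → ℝ} {i : ℕ} (h : IsKthBest M k x i) (y : ℝ) :
    x i ≤ y ↔ ((Finset.range M).filter (fun j => y < x j)).card < k := by
  obtain ⟨-, h1, h2⟩ := h
  constructor
  · intro hy
    refine (Finset.card_le_card fun j hj => ?_).trans_lt h1
    rw [Finset.mem_filter] at hj ⊢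
    exact ⟨hj.1, hy.trans_lt hj.2⟩
  · intro hy
    by_contra! hlt
    refine absurd (h2.trans (Finset.card_le_card fun j hj => ?_)) (not_le.2 hy)
    rw [Finset.mem_filter] at hj ⊢
    exact ⟨hj.1, hlt.trans_le hj.2⟩

section Binomial

variable {Ω : Type*} [MeasurableSpace Ω] {P : Measure Ω} [IsProbabilityMeasure P]
  {X : ℕ → Ω → ℝ}

lemma measureReal_exceedances_eq_finset (hX : ∀ i, AEMeasurable (X i) P) (hind : iIndepFun X P)
    {y p : ℝ} (hp : ∀ i, P.real {ω | y < X i ω} = p) {M : ℕ} {s : Finset ℕ}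
    (hs : s ⊆ Finset.range M) :
    P.real {ω | (Finset.range M).filter (fun j => y < X j ω) = s}
      = p ^ s.card * (1 - p) ^ (M - s.card) := by
  classical
  have hset : {ω | (Finset.range M).filter (fun j => y < X j ω) = s}
      = ⋂ i ∈ Finset.range M, X i ⁻¹' (if i ∈ s then Set.Ioi y else Set.Iic y) := by
    ext ω
    simp only [Set.mem_ofPred_eq, Set.mem_iInter, Set.mem_preimage, Finset.ext_iff,
      Finset.mem_filter]
    refine ⟨fun h i hi => ?_, fun h i => ?_⟩
    · split_ifs with his
      · exact ((h i).2 his).2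
      · exact not_lt.1 fun hlt => his ((h i).1 ⟨hi, hlt⟩)
    · refine ⟨fun hi => ?_, fun hi => ⟨hs hi, ?_⟩⟩
      · by_contra his
        have := h i hi.1
        rw [if_neg his] at this
        exact not_lt.2 this hi.2
      · have := h i (hs hi)
        rwa [if_pos hi] at this
  have hc : ∀ i, P.real (X i ⁻¹' Set.Iic y) = 1 - p := by
    intro i
    rw [← hp i, ← probReal_compl_eq_one_sub₀ (s := {ω | y < X i ω})
      ((hX i).nullMeasurable measurableSet_Ioi)]
    congr 1
    ext ω
    simp
  rw [hset, measureReal_def, hind.measure_inter_preimage_eq_mul (Finset.range M)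
    (fun i _ => by split_ifs <;> measurability), ENNReal.toReal_prod]
  calc _ = ∏ i ∈ Finset.range M, (if i ∈ s then p else 1 - p) := by
        refine Finset.prod_congr rfl fun i _ => ?_
        split_ifs
        · exact hp i
        · exact hc i
    _ = _ := by
        rw [Finset.prod_ite, Finset.prod_const, Finset.prod_const, Finset.filter_mem_eq_inter,
          Finset.inter_eq_right.2 hs, Finset.filter_not, Finset.filter_mem_eq_inter,
          Finset.inter_eq_right.2 hs, Finset.card_sdiff_of_subset hs, Finset.card_range]

/-- The number of exceedances of a level among `M` independent variables is binomial. -/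
lemma measureReal_card_exceedances_lt (hX : ∀ i, AEMeasurable (X i) P) (hind : iIndepFun X P)
    {y p : ℝ} (hp : ∀ i, P.real {ω | y < X i ω} = p) (M k : ℕ) :
    P.real {ω | ((Finset.range M).filter (fun j => y < X j ω)).card < k}
      = ∑ j ∈ Finset.range k, M.choose j * p ^ j * (1 - p) ^ (M - j) := by
  classical
  have hset : {ω | ((Finset.range M).filter (fun j => y < X j ω)).card < k}
      = ⋃ s ∈ (Finset.range k).biUnion (fun j => (Finset.range M).powersetCard j),
        {ω | (Finset.range M).filter (fun j => y < X j ω) = s} := by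
    ext ω
    simp [Finset.mem_powersetCard]
  have hmeas : ∀ s : Finset ℕ,
      NullMeasurableSet {ω | (Finset.range M).filter (fun j => y < X j ω) = s} P := by
    intro s
    have : {ω | (Finset.range M).filter (fun j => y < X j ω) = s}
        = ⋂ i : ℕ, {ω | (i < M ∧ y < X i ω) ↔ i ∈ s} := by
      ext ω
      simp [Finset.ext_iff]
    rw [this]
    refine NullMeasurableSet.iInter fun i => ?_
    have h1 : NullMeasurableSet {ω | y < X i ω} P := (hX i).nullMeasurable measurableSet_Ioi
    by_cases hiM : i < M <;> by_cases his : i ∈ s <;>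
      simp only [hiM, his, true_and, false_and, iff_true, iff_false]
    · exact h1
    · exact h1.compl
    · simp
    · simp
  rw [hset, measureReal_biUnion_finset₀ (fun s _ t _ hst => ?_) (fun s _ => hmeas s),
    Finset.sum_biUnion]
  · refine Finset.sum_congr rfl fun j _ => ?_
    rw [Finset.sum_congr rfl fun s hs => by
      rw [measureReal_exceedances_eq_finset hX hind hp (Finset.mem_powersetCard.1 hs).1,
        (Finset.mem_powersetCard.1 hs).2]]
    rw [Finset.sum_const, Finset.card_powersetCard, Finset.card_range, nsmul_eq_mul, mul_assoc]
  · intro i _ j _ hij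
    exact Finset.pairwise_disjoint_powersetCard _ hij
  · refine (Set.disjoint_left.2 fun ω h1 h2 => hst ?_).aedisjoint
    exact h1.symm.trans h2

/-- Poisson limit of the exceedance counts: if their means converge to `exp (-z)`, then the
probability of fewer than `k` exceedances converges to the Poisson probability `gumbelKth k z`. -/
lemma tendsto_measureReal_card_exceedances_lt (hX : ∀ i, AEMeasurable (X i) P)
    (hind : iIndepFun X P) {S : ℝ → ℝ} (hS : ∀ i y, P.real {ω | y < X i ω} = S y) {y : ℕ → ℝ}
    {z : ℝ} (hy : Tendsto (fun M : ℕ => M * S (y M)) atTop (𝓝 (Real.exp (-z)))) (k : ℕ) :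
    Tendsto (fun M : ℕ => P.real {ω | ((Finset.range M).filter (fun j => y M < X j ω)).card < k})
      atTop (𝓝 (gumbelKth k z)) := by
  simp_rw [fun M => measureReal_card_exceedances_lt hX hind (fun i => hS i (y M)) M k]
  have h := tendsto_finsetSum (Finset.range k) fun j _ =>
    tendsto_choose_mul_pow_of_tendsto_mul_atTop j hy
  convert h using 2
  rw [gumbelKth, Finset.mul_sum]
  refine Finset.sum_congr rfl fun j _ => ?_
  rw [← Real.exp_nat_mul, mul_div_assoc]
  simp

end Binomial

section Pairs

variable {Ω : Type*} [MeasurableSpace Ω] {P : Measure Ω} {β : Type*} [MeasurableSpace β]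

/-- If the families `g` and `h` are jointly independent, then the pairs `(g i, h i)` are
independent. -/
lemma iIndepFun_prodMk_of_sumElim [IsProbabilityMeasure P] {g h : ℕ → Ω → β}
    (hg : ∀ i, AEMeasurable (g i) P) (hh : ∀ i, AEMeasurable (h i) P)
    (hind : iIndepFun (Sum.elim g h) P) : iIndepFun (fun i ω => (g i ω, h i ω)) P := by
  classical
  have hgh : ∀ i, AEMeasurable (Sum.elim g h i) P := by rintro (i | i) <;> simp [hg, hh]
  rw [iIndepFun_iff_measure_inter_preimage_eq_mul]
  intro s
  induction s using Finset.induction_on with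
  | empty => simp
  | insert a s ha ih =>
    intro B hB
    rw [Finset.prod_insert ha, ← ih fun i hi => hB i (Finset.mem_insert_of_mem hi),
      Finset.set_biInter_insert]
    have hST : Disjoint (({a} : Finset ℕ).disjSum {a}) (s.disjSum s) := by
      rw [Finset.disjoint_left]
      rintro (i | i) hi hi' <;> simp_all
    have hi := hind.indepFun_finset₀ _ _ hST hgh
    let φ : ((({a} : Finset ℕ).disjSum {a}) → β) → β × β :=
      fun u => (u ⟨Sum.inl a, by simp⟩, u ⟨Sum.inr a, by simp⟩)
    let ψ : ((s.disjSum s) → β) → (s → β × β) :=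
      fun u i => (u ⟨Sum.inl i, by simp⟩, u ⟨Sum.inr i, by simp⟩)
    have hφ : Measurable φ := by fun_prop
    have hψ : Measurable ψ := by fun_prop
    have h2 := (hi.comp hφ hψ).measure_inter_preimage_eq_mul (B a)
      (⋂ i : s, (fun u : s → β × β => u i) ⁻¹' B i) (hB a (Finset.mem_insert_self a s))
      (MeasurableSet.iInter fun i => (measurable_pi_apply i)
        (hB i (Finset.mem_insert_of_mem i.2)))
    have he : ⋂ i ∈ s, (fun ω => (g i ω, h i ω)) ⁻¹' B i
        = (ψ ∘ fun ω i => Sum.elim g h i.1 ω) ⁻¹' ⋂ i : s, (fun u : s → β × β => u i) ⁻¹' B i := by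
      ext ω
      simp [ψ]
    rw [he]
    exact h2

end Pairs

/-! ### Pólya's theorem -/

/-- **Pólya's theorem**: pointwise convergence of monotone functions with values in `[0, 1]` to a
continuous distribution function is uniform. -/
lemma eventually_forall_abs_sub_lt_of_monotone {f : ℕ → ℝ → ℝ} {G : ℝ → ℝ}
    (hf : ∀ n, Monotone (f n)) (hf0 : ∀ n z, 0 ≤ f n z) (hf1 : ∀ n z, f n z ≤ 1)
    (hG : Continuous G)
    (hbot : Tendsto G atBot (𝓝 0)) (htop : Tendsto G atTop (𝓝 1))
    (hlim : ∀ z, Tendsto (fun n => f n z) atTop (𝓝 (G z))) {ε : ℝ} (hε : 0 < ε) :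
    ∀ᶠ n in atTop, ∀ z, |f n z - G z| < ε := by
  have hmono : Monotone G := fun x y hxy =>
    le_of_tendsto_of_tendsto' (hlim x) (hlim y) fun n => hf n hxy
  have hG0 : ∀ z, 0 ≤ G z := fun z => ge_of_tendsto' (hlim z) fun n => hf0 n z
  have hG1 : ∀ z, G z ≤ 1 := fun z => le_of_tendsto' (hlim z) fun n => hf1 n z
  have hε2 : 0 < ε / 2 := half_pos hε
  obtain ⟨A, hA⟩ := (hbot.eventually (gt_mem_nhds hε2)).exists
  obtain ⟨B, hB⟩ := (htop.eventually (lt_mem_nhds (sub_lt_self 1 hε2))).exists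
  -- below `A` and above `B` both functions are within `ε` by monotonicity; on `[A, B]`, squeeze `f n`
  -- between its values at the ends of short intervals and use compactness
  have hloc : ∀ x ∈ Set.Icc A B, ∃ t ∈ 𝓝[Set.Icc A B] x, ∀ᶠ n in atTop, ∀ z ∈ t,
      |f n z - G z| < ε := by
    intro x _
    have hx : ∀ᶠ y in 𝓝 x, |G y - G x| < ε / 4 := by
      have := Metric.tendsto_nhds.1 (hG.tendsto x) (ε / 4) (by positivity)
      simpa [Real.dist_eq] using this
    obtain ⟨δ, hδ, hb⟩ := Metric.eventually_nhds_iff.1 hx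
    have hl : |G (x - δ / 2) - G x| < ε / 4 := hb (by simp [abs_of_pos hδ, hδ])
    have hr : |G (x + δ / 2) - G x| < ε / 4 := hb (by simp [abs_of_pos hδ, hδ])
    refine ⟨Set.Icc (x - δ / 2) (x + δ / 2),
      mem_nhdsWithin_of_mem_nhds (Icc_mem_nhds (by linarith) (by linarith)), ?_⟩
    filter_upwards [Metric.tendsto_nhds.1 (hlim (x - δ / 2)) (ε / 4) (by positivity),
      Metric.tendsto_nhds.1 (hlim (x + δ / 2)) (ε / 4) (by positivity)] with n h1 h2 z hz
    rw [Real.dist_eq] at h1 h2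
    rw [abs_lt] at *
    have := hf n hz.1
    have := hf n hz.2
    have := hmono hz.1
    have := hmono hz.2
    constructor <;> linarith
  have hmid : ∀ᶠ n in atTop, ∀ z ∈ Set.Icc A B, |f n z - G z| < ε := by
    refine isCompact_Icc.induction_on (p := fun t => ∀ᶠ n in atTop, ∀ z ∈ t, |f n z - G z| < ε)
      ?_ ?_ ?_ hloc
    · simp
    · exact fun s t hst ht => ht.mono fun n hn z hz => hn z (hst hz)
    · intro s t hs ht
      filter_upwards [hs, ht] with n h1 h2 z hz
      exact hz.elim (h1 z) (h2 z)
  filter_upwards [hmid, Metric.tendsto_nhds.1 (hlim A) (ε / 2) hε2,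
    Metric.tendsto_nhds.1 (hlim B) (ε / 2) hε2] with n hn hnA hnB z
  rw [Real.dist_eq, abs_lt] at hnA hnB
  rcases lt_or_ge z A with hzA | hzA
  · have := hf n hzA.le
    have := hmono hzA.le
    have := hf0 n z
    have := hG0 z
    rw [abs_lt]
    constructor <;> linarith
  rcases lt_or_ge B z with hzB | hzB
  · have := hf n hzB.le
    have := hmono hzB.le
    have := hf1 n z
    have := hG1 z
    rw [abs_lt]
    constructor <;> linarith
  exact hn z ⟨hzA, hzB⟩

/-! ### The limit law -/

lemma gumbelKth_eq (k : ℕ) (z : ℝ) : gumbelKth k z =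
    ∑ j ∈ Finset.range k, Real.exp (-z) ^ j * Real.exp (-Real.exp (-z)) / j.factorial := by
  rw [gumbelKth, Finset.mul_sum]
  refine Finset.sum_congr rfl fun j _ => ?_
  rw [← Real.exp_nat_mul, mul_neg]
  ring

lemma continuous_gumbelKth (k : ℕ) : Continuous (gumbelKth k) := by
  unfold gumbelKth
  fun_prop

lemma tendsto_gumbelKth_atBot (k : ℕ) : Tendsto (gumbelKth k) atBot (𝓝 0) := by
  have hu : Tendsto (fun z : ℝ => Real.exp (-z)) atBot atTop :=
    Real.tendsto_exp_atTop.comp tendsto_neg_atBot_atTop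
  have h := tendsto_finsetSum (Finset.range k) fun j _ =>
    ((Real.tendsto_pow_mul_exp_neg_atTop_nhds_zero j).comp hu).div_const (j.factorial : ℝ)
  simpa [funext (gumbelKth_eq k)] using h

lemma tendsto_gumbelKth_atTop {k : ℕ} (hk : 1 ≤ k) : Tendsto (gumbelKth k) atTop (𝓝 1) := by
  have hc : Continuous fun u : ℝ =>
      ∑ j ∈ Finset.range k, u ^ j * Real.exp (-u) / (j.factorial : ℝ) := by fun_prop
  have h := (hc.tendsto 0).comp Real.tendsto_exp_neg_atTop_nhds_zero
  rw [Finset.sum_eq_single_of_mem 0 (Finset.mem_range.2 hk)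
    (fun j _ hj => by simp [hj])] at h
  simpa [funext (gumbelKth_eq k), Function.comp_def] using h

/-! ### The complex Gaussian law -/

instance : IsProbabilityMeasure stdComplexGaussian :=
  Measure.isProbabilityMeasure_map Complex.measurableEquivRealProd.symm.measurable.aemeasurable

open Real in
lemma lintegral_Ioi_mul_exp_neg_sq {x : ℝ} (hx : 0 ≤ x) :
    ∫⁻ r in Set.Ioi √x, ENNReal.ofReal (r * (π⁻¹ * exp (-r ^ 2)))
      = ENNReal.ofReal ((2 * π)⁻¹ * exp (-x)) := by
  have hder : ∀ r ∈ Set.Ici √x,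
      HasDerivAt (fun r => -((2 * π)⁻¹ * exp (-r ^ 2))) (r * (π⁻¹ * exp (-r ^ 2))) r := by
    intro r _
    have h := (((hasDerivAt_pow 2 r).neg.exp).const_mul (2 * π)⁻¹).neg
    refine HasDerivAt.congr_deriv h ?_
    simp only [Pi.neg_apply, Nat.cast_ofNat, Nat.add_one_sub_one, pow_one]
    ring
  have hnn : ∀ r ∈ Set.Ioi √x, 0 ≤ r * (π⁻¹ * exp (-r ^ 2)) := by
    intro r hr
    have : 0 ≤ r := (sqrt_nonneg x).trans (le_of_lt hr)
    positivity
  have hlim : Tendsto (fun r : ℝ => -((2 * π)⁻¹ * exp (-r ^ 2))) atTop (𝓝 0) := by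
    simpa using ((tendsto_exp_neg_atTop_nhds_zero.comp
      (tendsto_pow_atTop two_ne_zero)).const_mul (2 * π)⁻¹).neg
  have hint := integrableOn_Ioi_deriv_of_nonneg' hder hnn hlim
  rw [← ofReal_integral_eq_lintegral_ofReal hint
    ((ae_restrict_iff' measurableSet_Ioi).2 (ae_of_all _ hnn)),
    integral_Ioi_of_hasDerivAt_of_tendsto' hder hint hlim, sq_sqrt hx]
  congr 1
  ring

open Real in
lemma gaussianPDF_half_mul_gaussianPDF_half (p : ℝ × ℝ) :
    gaussianPDF 0 (1 / 2) p.1 * gaussianPDF 0 (1 / 2) p.2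
      = ENNReal.ofReal (π⁻¹ * exp (-(p.1 ^ 2 + p.2 ^ 2))) := by
  rw [gaussianPDF, gaussianPDF, ← ENNReal.ofReal_mul (gaussianPDFReal_nonneg _ _ _)]
  congr 1
  simp only [gaussianPDFReal, sub_zero, one_div, NNReal.coe_inv, NNReal.coe_ofNat]
  have h2 : 2 * π * 2⁻¹ = π := by ring
  rw [h2, mul_mul_mul_comm, ← mul_inv, mul_self_sqrt pi_pos.le, ← exp_add]
  congr 2
  ring

open Real in
/-- The squared modulus of a `CN(0,1)` variable is exponential with mean `1` (integrate the density
`π⁻¹ exp (-|z|²)` in polar coordinates). -/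
lemma stdComplexGaussian_norm_sq_gt {x : ℝ} (hx : 0 ≤ x) :
    stdComplexGaussian {z | x < ‖z‖ ^ 2} = ENNReal.ofReal (exp (-x)) := by
  have hms : MeasurableSet {p : ℝ × ℝ | x < p.1 ^ 2 + p.2 ^ 2} :=
    measurableSet_lt measurable_const (by fun_prop)
  have hpre : Complex.measurableEquivRealProd.symm ⁻¹' {z | x < ‖z‖ ^ 2}
      = {p : ℝ × ℝ | x < p.1 ^ 2 + p.2 ^ 2} := by
    ext p
    rw [Set.mem_preimage, Set.mem_ofPred_eq, Set.mem_ofPred_eq, Complex.sq_norm,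
      Complex.normSq_apply, sq, sq]
    rfl
  have hhalf : (1 / 2 : NNReal) ≠ 0 := by norm_num
  rw [stdComplexGaussian, MeasurableEquiv.map_apply, hpre, gaussianReal_of_var_ne_zero _ hhalf,
    prod_withDensity (measurable_gaussianPDF _ _) (measurable_gaussianPDF _ _),
    withDensity_apply _ hms]
  simp_rw [gaussianPDF_half_mul_gaussianPDF_half]
  rw [← Measure.volume_eq_prod, ← lintegral_indicator hms, ← lintegral_comp_polarCoord_symm]
  have hpolar : ∀ p ∈ polarCoord.target,
      ENNReal.ofReal p.1 • ({p : ℝ × ℝ | x < p.1 ^ 2 + p.2 ^ 2}.indicator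
        (fun p => ENNReal.ofReal (π⁻¹ * exp (-(p.1 ^ 2 + p.2 ^ 2)))) (polarCoord.symm p))
      = (Set.Ioi √x).indicator (fun r => ENNReal.ofReal (r * (π⁻¹ * exp (-r ^ 2)))) p.1 := by
    rintro ⟨r, θ⟩ hp
    have hr : 0 < r := by simpa using hp.1
    have hsq : (r * cos θ) ^ 2 + (r * sin θ) ^ 2 = r ^ 2 := by
      rw [mul_pow, mul_pow, ← mul_add, cos_sq_add_sin_sq, mul_one]
    have hiff : √x < r ↔ x < r ^ 2 := sqrt_lt' hr
    simp only [polarCoord_symm_apply, Set.indicator_apply, Set.mem_ofPred_eq, hsq, Set.mem_Ioi,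
      hiff, smul_eq_mul]
    split_ifs
    · rw [ENNReal.ofReal_mul hr.le]
    · rw [mul_zero]
  rw [setLIntegral_congr_fun polarCoord.open_target.measurableSet hpolar, polarCoord_target,
    Measure.volume_eq_prod, ← Measure.prod_restrict,
    lintegral_prod _ (by
      refine Measurable.aemeasurable
        (Measurable.comp (Measurable.indicator ?_ measurableSet_Ioi) measurable_fst)
      fun_prop)]
  simp only [lintegral_const, Measure.restrict_apply_univ, volume_Ioo]
  rw [lintegral_mul_const' _ _ ENNReal.ofReal_ne_top, lintegral_indicator measurableSet_Ioi,
    Measure.restrict_restrict measurableSet_Ioi,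
    Set.inter_eq_left.2 (Set.Ioi_subset_Ioi (sqrt_nonneg x)), lintegral_Ioi_mul_exp_neg_sq hx,
    ← ENNReal.ofReal_mul (by positivity)]
  congr 1
  field_simp
  ring

lemma stdComplexGaussian_ae_ne_zero : ∀ᵐ z ∂stdComplexGaussian, z ≠ 0 := by
  have h := stdComplexGaussian_norm_sq_gt le_rfl
  rw [neg_zero, Real.exp_zero, ENNReal.ofReal_one] at h
  have h' := (prob_compl_eq_zero_iff (measurableSet_lt measurable_const (by fun_prop))).2 h
  filter_upwards [(mem_ae_iff).2 h'] with z hz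
  rintro rfl
  simp at hz

/-! ### The generalized inverse of a continuous distribution function -/

lemma apply_invCDF {F : ℝ → ℝ} (hF : Continuous F) (hbot : Tendsto F atBot (𝓝 0))
    (htop : Tendsto F atTop (𝓝 1)) (hmono : Monotone F) {p : ℝ} (hp0 : 0 < p) (hp1 : p < 1) :
    F (invCDF F p) = p := by
  have hne : {y | p ≤ F y}.Nonempty :=
    ((htop.eventually (lt_mem_nhds hp1)).exists).imp fun y hy => le_of_lt hy
  obtain ⟨B, hB⟩ := (hbot.eventually (gt_mem_nhds hp0)).exists
  have hbdd : BddBelow {y | p ≤ F y} := ⟨B, fun y hy => by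
    by_contra! h
    exact absurd (hmono h.le) (not_le.2 (hB.trans_le hy))⟩
  have hmem : p ≤ F (invCDF F p) := (isClosed_le continuous_const hF).csInf_mem hne hbdd
  refine le_antisymm ?_ hmem
  -- `F < p` to the left of the infimum, so `F ≤ p` there by continuity
  refine le_of_tendsto ((hF.tendsto (invCDF F p)).mono_left (nhdsWithin_le_nhds
    (s := Set.Iio (invCDF F p)))) ?_
  filter_upwards [self_mem_nhdsWithin] with y hy
  exact (not_le.1 fun h => not_le.2 hy (csInf_le hbdd h)).le

/-! ### The signal-to-noise ratio of a device -/

namespace WPCN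

variable (W : WPCN)

/-- Supremum over `g` of the factor by which a device with energy-transfer coefficient `g`
multiplies `‖h‖ ^ 2` in its SNR. Saturation of the energy harvester makes it finite. -/
noncomputable def gainSup : ℝ := W.t₁ * (W.a * W.c - W.b) / (W.c * (W.t₂ * W.σ2))

/-- Reciprocal of the factor by which a device with energy-transfer coefficient `g` multiplies
`‖h‖ ^ 2` in its SNR. At `g = 0`, where that factor vanishes, it has the value `gainSup⁻¹` (as
`c / 0 = 0`), which is harmless since `g = 0` has probability zero. -/
noncomputable def invGain (g : ℂ) : ℝ := W.gainSup⁻¹ * (1 + W.c / (W.Pt * ‖g‖ ^ 2))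

lemma t₂_pos : 0 < W.t₂ := sub_pos.2 W.t₁_lt_one

lemma gainSup_pos : 0 < W.gainSup :=
  div_pos (mul_pos W.t₁_pos (sub_pos.2 W.b_lt)) (mul_pos W.c_pos (mul_pos W.t₂_pos W.σ2_pos))

lemma measurable_invGain : Measurable W.invGain := by
  unfold invGain
  fun_prop

lemma inv_gainSup_le_invGain (g : ℂ) : W.gainSup⁻¹ ≤ W.invGain g := by
  have h := inv_pos.2 W.gainSup_pos
  have := W.c_pos
  have := W.Pt_pos
  exact le_mul_of_one_le_right h.le (le_add_of_nonneg_right (by positivity))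

lemma invGain_pos (g : ℂ) : 0 < W.invGain g :=
  (inv_pos.2 W.gainSup_pos).trans_le (W.inv_gainSup_le_invGain g)

lemma snr_eq {g : ℂ} (hg : g ≠ 0) (h : ℂ) : W.snr g h = ‖h‖ ^ 2 / W.invGain g := by
  have hc := W.c_pos
  have hP := W.Pt_pos
  have h1 := W.t₁_pos
  have h2 := W.t₂_pos
  have hs := W.σ2_pos
  have hb : W.a * W.c - W.b ≠ 0 := (sub_pos.2 W.b_lt).ne'
  have hu : 0 < ‖g‖ := norm_pos_iff.2 hg
  have hd : W.Pt * ‖g‖ ^ 2 + W.c ≠ 0 := by positivity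
  rw [snr, energy, invGain, gainSup]
  field_simp
  ring

lemma snr_nonneg (g h : ℂ) : 0 ≤ W.snr g h := by
  rcases eq_or_ne g 0 with rfl | hg
  · simp [snr, energy]
  · rw [W.snr_eq hg]
    exact div_nonneg (sq_nonneg _) (W.invGain_pos g).le

lemma measurable_snr : Measurable fun p : ℂ × ℂ => W.snr p.1 p.2 := by
  unfold snr energy
  fun_prop

/-- `gainSup⁻¹` is the essential infimum of `invGain`, as `‖g‖` is unbounded. -/
lemma measure_invGain_le_pos {r : ℝ} (hr : W.gainSup⁻¹ < r) :
    0 < stdComplexGaussian {g | W.invGain g ≤ r} := by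
  have hK := W.gainSup_pos
  have hP := W.Pt_pos
  have hc := W.c_pos
  have hδ : 0 < r * W.gainSup - 1 := by
    rw [inv_lt_iff_one_lt_mul₀ hK] at hr
    linarith
  set x := W.c / (W.Pt * (r * W.gainSup - 1)) with hx
  have hx0 : 0 < x := by positivity
  refine lt_of_lt_of_le ?_ (measure_mono (s := {g : ℂ | x < ‖g‖ ^ 2}) fun g hg => ?_)
  · rw [stdComplexGaussian_norm_sq_gt hx0.le]
    exact ENNReal.ofReal_pos.2 (Real.exp_pos _)
  · have hg' : x < ‖g‖ ^ 2 := hg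
    have hg0 : 0 < ‖g‖ ^ 2 := hx0.trans hg'
    rw [hx, div_lt_iff₀ (by positivity)] at hg'
    have h1 : W.c / (W.Pt * ‖g‖ ^ 2) ≤ r * W.gainSup - 1 := by
      rw [div_le_iff₀ (by positivity)]
      linarith
    rw [Set.mem_ofPred_eq, invGain, inv_mul_le_iff₀ hK]
    linarith

/-- Conditionally on `g`, the SNR exceeds `x` with probability `exp (-x * invGain g)`, as `‖h‖ ^ 2` is
exponential; integrate over `g`. -/
lemma measure_snr_gt {x : ℝ} (hx : 0 ≤ x) :
    (stdComplexGaussian.prod stdComplexGaussian).real {p | x < W.snr p.1 p.2}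
      = laplaceTransform stdComplexGaussian W.invGain x := by
  have hm : MeasurableSet {p : ℂ × ℂ | x < W.snr p.1 p.2} :=
    measurableSet_lt measurable_const W.measurable_snr
  rw [measureReal_def, Measure.prod_apply hm, laplaceTransform,
    integral_eq_lintegral_of_nonneg_ae (ae_of_all _ fun g => (Real.exp_pos _).le)
      (by have := W.measurable_invGain; fun_prop)]
  congr 1
  refine lintegral_congr_ae ?_
  filter_upwards [stdComplexGaussian_ae_ne_zero] with g hg
  have hR := W.invGain_pos g
  rw [← stdComplexGaussian_norm_sq_gt (mul_nonneg hx hR.le)]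
  congr 1
  ext h
  simp only [Set.mem_preimage, Set.mem_ofPred_eq, W.snr_eq hg, lt_div_iff₀ hR]

/-- The probability that the SNR of a device exceeds `x`. The SNR being nonnegative and almost surely
positive, the truncation `max x 0` gives the value `1` for `x ≤ 0`. -/
noncomputable def snrTail (x : ℝ) : ℝ :=
  laplaceTransform stdComplexGaussian W.invGain (max x 0)

lemma measure_snr_gt_eq_snrTail (x : ℝ) :
    (stdComplexGaussian.prod stdComplexGaussian).real {p | x < W.snr p.1 p.2} = W.snrTail x := by
  rcases le_or_gt 0 x with hx | hx
  · rw [snrTail, max_eq_left hx, W.measure_snr_gt hx]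
  · have : {p : ℂ × ℂ | x < W.snr p.1 p.2} = Set.univ :=
      Set.eq_univ_of_forall fun p => hx.trans_le (W.snr_nonneg _ _)
    rw [this, probReal_univ, snrTail, max_eq_right hx.le, laplaceTransform_zero]

lemma snrTail_pos (x : ℝ) : 0 < W.snrTail x :=
  laplaceTransform_pos W.measurable_invGain (ae_of_all _ W.invGain_pos) (le_max_right x 0)

lemma antitone_snrTail : Antitone W.snrTail := fun x y hxy =>
  antitoneOn_laplaceTransform W.measurable_invGain (ae_of_all _ W.invGain_pos)
    (le_max_right x 0) (le_max_right y 0) (max_le_max_right 0 hxy)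

lemma continuous_snrTail : Continuous W.snrTail :=
  (continuousOn_laplaceTransform W.measurable_invGain
    (ae_of_all _ W.invGain_pos)).comp_continuous (by fun_prop) fun x => le_max_right x 0

lemma tendsto_snrTail_shift (t : ℝ) :
    Tendsto (fun x => W.snrTail (x + t) / W.snrTail x) atTop
      (𝓝 (Real.exp (-(W.gainSup⁻¹ * t)))) := by
  refine (tendsto_laplaceTransform_shift W.measurable_invGain (inv_pos.2 W.gainSup_pos)
    (ae_of_all _ W.inv_gainSup_le_invGain) (fun r hr => W.measure_invGain_le_pos hr) t).congr' ?_
  filter_upwards [eventually_ge_atTop 0, eventually_ge_atTop (-t)] with x hx hxt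
  rw [snrTail, snrTail, max_eq_left hx, max_eq_left (by linarith)]

/-- The rate constraint as an SNR constraint; `0 ≤ X` keeps `logb` off its junk values. -/
lemma rate_le_iff {X : ℝ} (hX : 0 ≤ X) (Q : ℝ) :
    W.t₂ * Real.logb 2 (1 + X) ≤ Q ↔ X ≤ (2 : ℝ) ^ (Q / W.t₂) - 1 := by
  rw [← le_div_iff₀' W.t₂_pos, Real.logb_le_iff_le_rpow one_lt_two (by linarith),
    le_sub_iff_add_le']

end WPCN

theorem proposition1 (W : WPCN) {Ω : Type*} [MeasurableSpace Ω]
    (P : Measure Ω) [IsProbabilityMeasure P]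
    -- channel coefficients of the devices: mutually independent, each of law CN(0,1)
    (g h : ℕ → Ω → ℂ)
    (hg : ∀ i, HasLaw (g i) stdComplexGaussian P)
    (hh : ∀ i, HasLaw (h i) stdComplexGaussian P)
    (hind : iIndepFun (Sum.elim g h) P)
    -- the SNRs of the devices
    (X : ℕ → Ω → ℝ) (hX : ∀ i ω, X i ω = W.snr (g i ω) (h i ω))
    -- the distribution function of the SNR of a device (the same for all devices)
    (F : ℝ → ℝ) (i₀ : ℕ) (hF : F = cdf (P.map (X i₀)))
    -- SNR-based selection of the k-th best among the first M devices
    (k : ℕ) (hk : 1 ≤ k) (sel : ℕ → Ω → ℕ)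
    (hsel : ∀ M, k ≤ M → ∀ ω, IsKthBest M k (fun i => X i ω) (sel M ω)) :
    -- the normalizing constants
    (∀ M : ℕ, 2 ≤ M →
      F (normEta F M) = 1 - 1 / (M : ℝ) ∧
      F (normEta F M + normXi F M) = 1 - 1 / (Real.exp 1 * (M : ℝ)) ∧
      0 < normXi F M) ∧
    -- limit law of the normalized SNR of the selected device
    (∀ z : ℝ, Tendsto
      (fun M : ℕ => P.real {ω | (X (sel M ω) ω - normEta F M) / normXi F M ≤ z})
      atTop (𝓝 (gumbelKth k z))) ∧
    -- asymptotic outage probability, uniformly in the threshold level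
    (∀ ε : ℝ, 0 < ε → ∀ᶠ M : ℕ in atTop, ∀ Q x : ℝ, x = (2 : ℝ) ^ (Q / W.t₂) - 1 →
      |W.outage P (fun ω => X (sel M ω) ω) Q
        - gumbelKth k ((x - normEta F M) / normXi F M)| < ε) := by
  have hXeq : ∀ i, X i = (fun p : ℂ × ℂ => W.snr p.1 p.2) ∘ fun ω => (g i ω, h i ω) :=
    fun i => funext (hX i)
  have hpair : ∀ i, AEMeasurable (fun ω => (g i ω, h i ω)) P := fun i =>
    (hg i).aemeasurable.prodMk (hh i).aemeasurable
  have hXm : ∀ i, AEMeasurable (X i) P := fun i => by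
    rw [hXeq i]
    exact W.measurable_snr.comp_aemeasurable (hpair i)
  have hXind : iIndepFun X P := by
    have := (iIndepFun_prodMk_of_sumElim (fun i => (hg i).aemeasurable)
      (fun i => (hh i).aemeasurable) hind).comp (fun _ p => W.snr p.1 p.2)
        fun _ => W.measurable_snr
    rwa [show X = _ from funext hXeq]
  have htail : ∀ i y, P.real {ω | y < X i ω} = W.snrTail y := by
    intro i y
    have hi : IndepFun (g i) (h i) P :=
      hind.indepFun (i := Sum.inl i) (j := Sum.inr i) Sum.inl_ne_inr
    have hlaw := (indepFun_iff_map_prod_eq_prod_map_map (hg i).aemeasurable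
      (hh i).aemeasurable).1 hi
    rw [(hg i).map_eq, (hh i).map_eq] at hlaw
    rw [← W.measure_snr_gt_eq_snrTail, ← hlaw, map_measureReal_apply_of_aemeasurable (hpair i)
      (measurableSet_lt measurable_const W.measurable_snr)]
    simp_rw [hX]
    rfl
  have : IsProbabilityMeasure (P.map (X i₀)) := Measure.isProbabilityMeasure_map (hXm i₀)
  have hFS : ∀ y, F y = 1 - W.snrTail y := by
    intro y
    rw [hF, cdf_eq_real, map_measureReal_apply_of_aemeasurable (hXm i₀) measurableSet_Iic,
      ← htail i₀ y, ← probReal_compl_eq_one_sub₀ (s := {ω | y < X i₀ ω})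
      ((hXm i₀).nullMeasurable measurableSet_Ioi)]
    congr 1
    ext ω
    simp
  have hFc : Continuous F := by
    rw [funext hFS]
    exact continuous_const.sub W.continuous_snrTail
  have hFmono : Monotone F := hF ▸ monotone_cdf _
  have hFinv : ∀ p, 0 < p → p < 1 → F (invCDF F p) = p := fun p =>
    apply_invCDF hFc (hF ▸ tendsto_cdf_atBot _) (hF ▸ tendsto_cdf_atTop _) hFmono
  have hnorm : ∀ M : ℕ, 2 ≤ M →
      F (normEta F M) = 1 - 1 / (M : ℝ) ∧
      F (normEta F M + normXi F M) = 1 - 1 / (Real.exp 1 * (M : ℝ)) ∧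
      0 < normXi F M := by
    intro M hM
    have hM' : (1 : ℝ) < M := by exact_mod_cast hM
    have he : (1 : ℝ) < Real.exp 1 := Real.one_lt_exp_iff.2 one_pos
    have heM : (M : ℝ) < Real.exp 1 * M := lt_mul_of_one_lt_left (by linarith) he
    have h1 : 1 / (M : ℝ) < 1 := (div_lt_one (by linarith)).2 hM'
    have h2 : 1 / (Real.exp 1 * (M : ℝ)) < 1 / M := one_div_lt_one_div_of_lt (by linarith) heM
    have h3 : 0 < 1 / (Real.exp 1 * (M : ℝ)) := by positivity
    have hη : F (normEta F M) = 1 - 1 / (M : ℝ) := hFinv _ (by linarith) (by linarith)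
    have hξ : F (normEta F M + normXi F M) = 1 - 1 / (Real.exp 1 * (M : ℝ)) := by
      rw [normXi, add_sub_cancel]
      exact hFinv _ (by linarith) (by linarith)
    refine ⟨hη, hξ, ?_⟩
    have hlt : normEta F M < normEta F M + normXi F M := hFmono.reflect_lt (by linarith)
    linarith
  have hηS : ∀ᶠ M : ℕ in atTop, M * W.snrTail (normEta F M) = 1 := by
    filter_upwards [eventually_ge_atTop 2] with M hM
    have h1 := (hnorm M hM).1
    rw [hFS, sub_right_inj] at h1
    rw [h1, mul_one_div_cancel (by positivity)]
  have hξS : ∀ᶠ M : ℕ in atTop, M * W.snrTail (normEta F M + normXi F M) = Real.exp (-1) := by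
    filter_upwards [eventually_ge_atTop 2] with M hM
    have h1 := (hnorm M hM).2.1
    rw [hFS, sub_right_inj] at h1
    rw [h1, Real.exp_neg]
    field_simp
  have hlim : ∀ z : ℝ, Tendsto
      (fun M : ℕ => P.real {ω | (X (sel M ω) ω - normEta F M) / normXi F M ≤ z})
      atTop (𝓝 (gumbelKth k z)) := by
    intro z
    refine (tendsto_measureReal_card_exceedances_lt hXm hXind htail
      (tendsto_mul_tail_normalized (inv_pos.2 W.gainSup_pos) W.antitone_snrTail W.snrTail_pos
        W.tendsto_snrTail_shift hηS hξS z) k).congr' ?_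
    filter_upwards [eventually_ge_atTop 2, eventually_ge_atTop k] with M hM hkM
    congr 1
    ext ω
    rw [Set.mem_ofPred_eq, Set.mem_ofPred_eq, div_le_iff₀ (hnorm M hM).2.2, sub_le_iff_le_add']
    exact ((hsel M hkM ω).le_iff _).symm
  refine ⟨hnorm, hlim, fun ε hε => ?_⟩
  have huniform := eventually_forall_abs_sub_lt_of_monotone
    (f := fun M z => P.real {ω | (X (sel M ω) ω - normEta F M) / normXi F M ≤ z})
    (fun M y z hyz => measureReal_mono fun ω hω => le_trans hω hyz)
    (fun M z => measureReal_nonneg) (fun M z => measureReal_le_one)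
    (continuous_gumbelKth k) (tendsto_gumbelKth_atBot k) (tendsto_gumbelKth_atTop hk) hlim hε
  filter_upwards [huniform, eventually_ge_atTop 2] with M hM hM2 Q x hx
  convert hM ((x - normEta F M) / normXi F M) using 4
  rw [WPCN.outage]
  congr 1
  ext ω
  rw [Set.mem_ofPred_eq, Set.mem_ofPred_eq, div_le_div_iff_of_pos_right (hnorm M hM2).2.2,
    sub_le_sub_iff_right, hx]
  exact W.rate_le_iff (hX _ ω ▸ W.snr_nonneg _ _) Q
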